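/- Let $A\ge 2$ and $a\in\{1,\dots,A-1\}$. For $i\in\{1,\dots,A\}$ let $F_i\colon\{1,2,\dots\}\to(0,\infty)$ be a feedback function and $X_i(0)\in\{1,2,\dots\}$ an initial value, and let $\tau_i(k)$ ($1\le i\le A$, $k\ge1$) be independent random variables, $\tau_i(k)$ being exponentially distributed with parameter $F_i(k)$. For $t\in[0,\infty)$ set $$\Xi_i(t)=\min\Big\{k\colon \sum_{l=X_i(0)}^k\tau_i(l)>t\Big\}\quad(\min\emptyset=\infty),\qquad T_i=\sum_{k=X_i(0)}^\infty\tau_i(k)\in(0,\infty],$$ so that $\Xi_1,\dots,\Xi_A$ are independent birth processes with explosion times $T_i$. Let $t_0=0$, $t_{n+1}=\inf\{t>t_n\colon \Xi(t)\ne\Xi(t_n)\}$ be the jump times of $\Xi=(\Xi_1,\dots,\Xi_A)$, and let $X(n)=\Xi(t_n)$ be the generalized Pólya urn with feedback functions $F_i$, constructed by this exponential embedding. Put $X_i(\infty)=\lim_{n\to\infty}X_i(n)\in\{1,2,\dots\}\cup\{\infty\}$. Call colour $i$ explosive if $\sum_{k=1}^\infty 1/F_i(k)<\infty$. Assume that at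 least $a+1$ colours are explosive and that colours $1,\dots,a$ are among them. Set $$S=\min\{T_j\colon j=a+1,\dots,A\},\qquad S_i=\min\{T_j\colon j\ne i\}.$$ Then, for $i=1,\dots,a$, the distribution function of $T_i$ is differentiable, with derivative $g_i(t)=\frac{d}{dt}\mathbb P(T_i\le t)$; the times $S$ and $S_i$ are almost surely finite; the expectations $\mathbb E\big[\prod_{i=1}^a g_i(S)\big]$ and $\mathbb E\,g_i(S_i)$ are finite and positive; and $$\mathbb P\big(X_1(\infty)=x_1,\dots,X_a(\infty)=x_a\big)\sim\frac{\mathbb E\big[\prod_{i=1}^a g_i(S)\big]}{\prod_{i=1}^a\mathbb E\,g_i(S_i)}\cdot\prod_{i=1}^a\mathbb P\big(X_i(\infty)=x_i\big)\qquad\text{as }x_1,\dots,x_a\to\infty,$$ that is, the quotient of the two sides tends to $1$ when all $x_i$ tend to infinity jointly. -/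

import Mathlib

open MeasureTheory ProbabilityTheory Filter Topology
open scoped ENNReal

noncomputable section

namespace PolyaUrn

/-- The condition `∑_{k ≥ 1} 1 / F k < ∞` on a feedback function `F : {1, 2, …} → (0, ∞)`
(the value `F 0` plays no role). -/
def Explosive (F : ℕ → ℝ) : Prop :=
  Summable fun k : ℕ => 1 / F (k + 1)

/-- The birth process started in `m` with sojourn times `τ m, τ (m + 1), …` at time `t`:
`min {k | τ m + ⋯ + τ k > t}`, where `min ∅ = ∞`. -/
def birthProcess (m : ℕ) (τ : ℕ → ℝ) (t : ℝ≥0∞) : ℕ∞ :=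
  sInf ((fun k : ℕ => (k : ℕ∞)) '' {k | t < ∑ l ∈ Finset.Icc m k, ENNReal.ofReal (τ l)})

/-- The explosion time `∑_{k ≥ m} τ k ∈ [0, ∞]` of the birth process. -/
def explosionTime (m : ℕ) (τ : ℕ → ℝ) : ℝ≥0∞ :=
  ∑' k : ℕ, ENNReal.ofReal (τ (m + k))

/-- The combined process `t ↦ (Ξ_i(t))_i`, where `Ξ_i` starts in `m i` and has
sojourn times `τ i`. -/
def combinedProcess {ι : Type*} (m : ι → ℕ) (τ : ι → ℕ → ℝ) (t : ℝ≥0∞) : ι → ℕ∞ :=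
  fun i => birthProcess (m i) (τ i) t

/-- The jump times of the combined process: `t_0 = 0` and
`t_{n+1} = inf {t > t_n | Ξ(t) ≠ Ξ(t_n)}`. -/
def jumpTime {ι : Type*} (m : ι → ℕ) (τ : ι → ℕ → ℝ) : ℕ → ℝ≥0∞
  | 0 => 0
  | n + 1 => sInf {t | jumpTime m τ n < t ∧
      combinedProcess m τ t ≠ combinedProcess m τ (jumpTime m τ n)}

/-- The generalized Pólya urn, constructed by the exponential embedding:
`X(n) = Ξ(t_n)`. -/
def urn {ι : Type*} (m : ι → ℕ) (τ : ι → ℕ → ℝ) (n : ℕ) : ι → ℕ∞ :=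
  combinedProcess m τ (jumpTime m τ n)

/-- The final number `X_i(∞) = lim_n X_i(n) ∈ ℕ ∪ {∞}` of balls of colour `i`.
As `X_i(n)` is nondecreasing in `n`, the limit is the supremum, see `tendsto_urn`. -/
def urnLimit {ι : Type*} (m : ι → ℕ) (τ : ι → ℕ → ℝ) (i : ι) : ℕ∞ :=
  ⨆ n : ℕ, urn m τ n i

theorem birthProcess_mono (m : ℕ) (τ : ℕ → ℝ) : Monotone (birthProcess m τ) := by
  intro s t hst
  apply sInf_le_sInf
  apply Set.image_mono
  intro k hk
  exact lt_of_le_of_lt hst hk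

theorem jumpTime_mono {ι : Type*} (m : ι → ℕ) (τ : ι → ℕ → ℝ) :
    Monotone (jumpTime m τ) := by
  apply monotone_nat_of_le_succ
  intro n
  rw [jumpTime]
  exact le_sInf fun t ht => ht.1.le

theorem tendsto_urn {ι : Type*} (m : ι → ℕ) (τ : ι → ℕ → ℝ) (i : ι) :
    Tendsto (fun n => urn m τ n i) atTop (𝓝 (urnLimit m τ i)) :=
  tendsto_atTop_iSup fun _ _ h => birthProcess_mono _ _ (jumpTime_mono m τ h)

/-- The distribution function `t ↦ P(T ≤ t)` of a random time `T ∈ [0, ∞]`. -/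
def timeCDF {Ω : Type*} [MeasurableSpace Ω] (P : Measure Ω) (T : Ω → ℝ≥0∞) (t : ℝ) : ℝ :=
  P.real {ω | T ω ≤ ENNReal.ofReal t}

/-- The density `g(t) = d/dt P(T ≤ t)` of a random time `T`. -/
def timeDensity {Ω : Type*} [MeasurableSpace Ω] (P : Measure Ω) (T : Ω → ℝ≥0∞) : ℝ → ℝ :=
  deriv (timeCDF P T)

/-- `min {T_i | i = a + 1, …, A}`; the colours `a + 1, …, A` are the indices `≥ a`
in `Fin A`, which counts from `0`. -/
def minTimeFrom {A : ℕ} (a : ℕ) (T : Fin A → ℝ≥0∞) : ℝ≥0∞ :=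
  ⨅ j : Fin A, ⨅ _ : a ≤ (j : ℕ), T j

/-- `min {T_j | j ≠ i}`. -/
def minTimeOther {A : ℕ} (i : Fin A) (T : Fin A → ℝ≥0∞) : ℝ≥0∞ :=
  ⨅ j : Fin A, ⨅ _ : j ≠ i, T j

end PolyaUrn

end

/-! The jump times of the combined process increase to the first explosion time. Hence, almost
surely, all selected colours have finite final numbers `x l` exactly when the first explosion `S`
among the other colours falls, for each `l`, between the births `x l - 1 → x l` and `x l → x l + 1`
of colour `l`. This is `forall_urnLimit_eq_iff`.

The selected colours are independent of one another and of `S`. Given `S = s`, the probability is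
therefore a product of one-colour terms. By the forward equation for sums of exponential variables,
each term equals `f (s) / F (x l)`, where `f` is the density of the time of the birth `x l → x l +
1` and `F (x l)` is the rate of the last summand (`measureReal_partialSum`).

The first two sojourn times already have a sum with a bounded continuous density. Adding the
remaining independent sojourn times averages translates of this density. So the densities of the
birth times obey one uniform bound and converge pointwise to the density of the explosion time
(`sumDensity_eq_integral`, `tendsto_sumDensity`). Dominated convergence shows that the joint
probability times `∏ F (x l)` tends to the expected product of explosion densities at `S`
(`tendsto_measureReal_mul_prod`).

Using this once for all selected colours and once for each colour alone, the rates cancel in the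
quotient and only the constants remain. These are positive because an explosion density is positive
on `(0, ∞)`. -/

namespace PolyaUrn

/-! ### Distribution functions and sums with an independent variable -/

section OneDim

variable {Ω : Type*} [MeasurableSpace Ω] {P : Measure Ω}

/-- The distribution function of a real random variable. -/
noncomputable def distFun (P : Measure Ω) (Z : Ω → ℝ) (s : ℝ) : ℝ := P.real {ω | Z ω ≤ s}

theorem distFun_nonneg (Z : Ω → ℝ) (s : ℝ) : 0 ≤ distFun P Z s := measureReal_nonneg

theorem distFun_le_one [IsProbabilityMeasure P] (Z : Ω → ℝ) (s : ℝ) : distFun P Z s ≤ 1 :=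
  measureReal_le_one

theorem distFun_mono [IsProbabilityMeasure P] (Z : Ω → ℝ) : Monotone (distFun P Z) := fun _ _ h =>
  measureReal_mono fun _ hω => le_trans hω h

theorem distFun_of_neg {Z : Ω → ℝ} (hZ : ∀ᵐ ω ∂P, 0 ≤ Z ω) {s : ℝ} (hs : s < 0) :
    distFun P Z s = 0 := by
  have : P {ω | Z ω ≤ s} = 0 := by
    rw [← nonpos_iff_eq_zero, ← ae_iff.1 hZ]
    refine measure_mono fun ω hω => ?_
    simp only [Set.mem_ofPred_eq, not_le] at hω ⊢
    linarith
  simp [distFun, measureReal_def, this]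

/-- Fubini's theorem for the probability of an event involving two independent variables. -/
theorem measureReal_indep_eq_integral [IsProbabilityMeasure P] {α β : Type*}
    [MeasurableSpace α] [MeasurableSpace β]
    {U : Ω → α} {V : Ω → β} (hU : Measurable U) (hV : Measurable V) (hUV : IndepFun U V P)
    {B : Set (α × β)} (hB : MeasurableSet B) :
    P.real {ω | (U ω, V ω) ∈ B} = ∫ ω, P.real {ω' | (U ω', V ω) ∈ B} ∂P := by
  have hU' : IsProbabilityMeasure (P.map U) := Measure.isProbabilityMeasure_map hU.aemeasurable
  have hV' : IsProbabilityMeasure (P.map V) := Measure.isProbabilityMeasure_map hV.aemeasurable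
  have h1 : P {ω | (U ω, V ω) ∈ B} = ∫⁻ ω, P {ω' | (U ω', V ω) ∈ B} ∂P := by
    have : {ω | (U ω, V ω) ∈ B} = (fun ω => (U ω, V ω)) ⁻¹' B := rfl
    rw [this, ← Measure.map_apply (hU.prodMk hV) hB,
      (indepFun_iff_map_prod_eq_prod_map_map hU.aemeasurable hV.aemeasurable).1 hUV,
      Measure.prod_apply_symm hB, lintegral_map (measurable_measure_prodMk_right hB) hV]
    refine lintegral_congr fun ω => ?_
    rw [Measure.map_apply hU (measurable_prodMk_right hB)]
    rfl
  rw [measureReal_def, h1, ← integral_toReal]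
  · rfl
  · have : Measurable fun ω => (P.map U) ((fun x => (x, V ω)) ⁻¹' B) :=
      (measurable_measure_prodMk_right hB).comp hV
    convert this.aemeasurable using 2 with ω
    rw [Measure.map_apply hU (measurable_prodMk_right hB)]
    rfl
  · exact ae_of_all _ fun ω => measure_lt_top _ _

theorem distFun_add [IsProbabilityMeasure P] {Z R : Ω → ℝ} (hZ : Measurable Z) (hR : Measurable R)
    (h : IndepFun Z R P)
    (s : ℝ) : distFun P (fun ω => Z ω + R ω) s = ∫ ω, distFun P Z (s - R ω) ∂P := by
  have := measureReal_indep_eq_integral hZ hR h (B := {p : ℝ × ℝ | p.1 + p.2 ≤ s})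
    (measurableSet_le (by fun_prop) (by fun_prop))
  simp only [distFun, Set.mem_ofPred_eq, le_sub_iff_add_le] at this ⊢
  exact this

theorem integrable_of_measurable_of_bound {α : Type*} [MeasurableSpace α] {μ : Measure α}
    [IsFiniteMeasure μ] {f : α → ℝ} (hf : Measurable f) (M : ℝ) (hM : ∀ x, |f x| ≤ M) :
    Integrable f μ :=
  Integrable.of_bound hf.aestronglyMeasurable M (ae_of_all _ hM)

/-- If the distribution function of `Z` has a bounded derivative `h`, then that of `Z + R` has the
derivative `s ↦ E h(s - R)`, for every `R` independent of `Z`. -/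
theorem hasDerivAt_distFun_add [IsProbabilityMeasure P] {Z R : Ω → ℝ}
    (hZ : Measurable Z) (hR : Measurable R)
    (hZR : IndepFun Z R P) {h : ℝ → ℝ} {M : ℝ} (hM : ∀ s, |h s| ≤ M)
    (hd : ∀ s, HasDerivAt (distFun P Z) (h s) s) (s : ℝ) :
    HasDerivAt (distFun P fun ω => Z ω + R ω) (∫ ω, h (s - R ω) ∂P) s := by
  have hh : Measurable h := by
    have : h = deriv (distFun P Z) := by ext s; exact (hd s).deriv.symm
    rw [this]; exact measurable_deriv _
  have hC : Measurable (distFun P Z) := (distFun_mono Z).measurable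
  have e : distFun P (fun ω => Z ω + R ω) = fun s => ∫ ω, distFun P Z (s - R ω) ∂P := by
    ext s; exact distFun_add hZ hR hZR s
  rw [e]
  refine (hasDerivAt_integral_of_dominated_loc_of_deriv_le (bound := fun _ => M)
    (F := fun s ω => distFun P Z (s - R ω)) (F' := fun s ω => h (s - R ω))
    (s := Set.univ) univ_mem ?_ ?_ ?_ ?_ ?_ ?_).2
  · exact Eventually.of_forall fun x =>
      (hC.comp (measurable_const.sub hR)).aestronglyMeasurable
  · refine integrable_of_measurable_of_bound (hC.comp (measurable_const.sub hR)) 1 fun ω => ?_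
    rw [abs_of_nonneg (distFun_nonneg _ _)]
    exact distFun_le_one _ _
  · exact (hh.comp (measurable_const.sub hR)).aestronglyMeasurable
  · exact ae_of_all _ fun ω x _ => hM _
  · exact integrable_const _
  · exact ae_of_all _ fun ω x _ => (hd (x - R ω)).comp_sub_const x (R ω)

theorem integral_expMeasure {r : ℝ} (hr : 0 < r) (f : ℝ → ℝ) :
    ∫ x, f x ∂(expMeasure r) = ∫ x, exponentialPDFReal r x * f x := by
  have : expMeasure r = volume.withDensity fun x => ENNReal.ofReal (exponentialPDFReal r x) := rfl
  rw [this, integral_withDensity_eq_integral_toReal_smul (by fun_prop)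
    (ae_of_all _ fun _ => ENNReal.ofReal_lt_top)]
  simp [ENNReal.toReal_ofReal (exponentialPDFReal_nonneg hr _)]

theorem exponentialPDFReal_eq (r x : ℝ) :
    exponentialPDFReal r x = if 0 ≤ x then r * Real.exp (-(r * x)) else 0 := by
  rw [exponentialPDFReal, gammaPDFReal]
  simp

theorem distFun_exp {V : Ω → ℝ} {r : ℝ} (hr : 0 < r) (hV : HasLaw V (expMeasure r) P) (s : ℝ) :
    distFun P V s = if 0 ≤ s then 1 - Real.exp (-(r * s)) else 0 := by
  have := isProbabilityMeasure_expMeasure hr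
  rw [← cdf_expMeasure_eq hr, cdf_eq_real, measureReal_def, distFun, measureReal_def]
  congr 1
  exact hV.measure_eq measurableSet_Iic

theorem ae_pos_exp [IsProbabilityMeasure P] {V : Ω → ℝ} {r : ℝ} (hr : 0 < r)
    (hV : HasLaw V (expMeasure r) P) :
    ∀ᵐ ω ∂P, 0 < V ω := by
  have := distFun_exp hr hV 0
  simp only [le_refl, mul_zero, neg_zero, Real.exp_zero, sub_self, if_true, distFun] at this
  rw [measureReal_eq_zero_iff] at this
  rw [ae_iff]
  simpa using this

theorem distFun_exp_continuous {V : Ω → ℝ} {r : ℝ} (hr : 0 < r)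
    (hV : HasLaw V (expMeasure r) P) : Continuous (distFun P V) := by
  have : distFun P V = fun s => if 0 ≤ s then 1 - Real.exp (-(r * s)) else 0 := by
    ext s; exact distFun_exp hr hV s
  rw [this]
  refine Continuous.if_le (by fun_prop) continuous_const continuous_const continuous_id ?_
  rintro s rfl
  simp

/-- The convolution of a distribution function on `[0, ∞)` with an exponential distribution. -/
theorem distFun_add_exp [IsProbabilityMeasure P] {Z V : Ω → ℝ} {r : ℝ}
    (hr : 0 < r) (hZ : Measurable Z)
    (hZ0 : ∀ᵐ ω ∂P, 0 ≤ Z ω) (hVm : Measurable V) (hV : HasLaw V (expMeasure r) P)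
    (h : IndepFun Z V P) (s : ℝ) :
    distFun P (fun ω => Z ω + V ω) s =
      r * Real.exp (-(r * s)) * ∫ v in (0 : ℝ)..s, Real.exp (r * v) * distFun P Z v := by
  have hC : Measurable (distFun P Z) := (distFun_mono Z).measurable
  have e1 : distFun P (fun ω => Z ω + V ω) s =
      ∫ v, exponentialPDFReal r (s - v) * distFun P Z v := by
    -- Reflecting `v ↦ s - v` puts the exponential density, rather than the distribution function,
    -- at the shifted argument.
    rw [distFun_add hZ hVm h, ← integral_sub_left_eq_self _ volume s]
    simp only [sub_sub_cancel]
    rw [← integral_expMeasure hr, ← hV.map_eq, integral_map hVm.aemeasurable]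
    exact (hC.comp (measurable_const.sub measurable_id)).aestronglyMeasurable
  rw [e1, ← intervalIntegral.integral_const_mul]
  rcases le_or_gt 0 s with hs | hs
  · rw [intervalIntegral.integral_of_le hs, ← integral_indicator measurableSet_Ioc]
    refine integral_congr_ae ?_
    filter_upwards [Measure.ae_ne volume (0 : ℝ)] with v hv
    rw [exponentialPDFReal_eq]
    by_cases h1 : v ∈ Set.Ioc 0 s
    · rw [Set.indicator_of_mem h1, if_pos (sub_nonneg.2 h1.2)]
      have : -(r * (s - v)) = -(r * s) + r * v := by ring
      rw [this, Real.exp_add]; ring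
    · rw [Set.indicator_of_notMem h1]
      rcases lt_or_gt_of_ne hv with h2 | h2
      · rw [distFun_of_neg hZ0 h2, mul_zero]
      · rw [if_neg, zero_mul]
        intro h3
        exact h1 ⟨h2, by linarith⟩
  · rw [intervalIntegral.integral_symm, intervalIntegral.integral_of_le hs.le,
      setIntegral_eq_zero_of_ae_eq_zero, neg_zero]
    · refine integral_eq_zero_of_ae (ae_of_all _ fun v => ?_)
      change exponentialPDFReal r (s - v) * distFun P Z v = 0
      rw [exponentialPDFReal_eq]
      rcases le_or_gt v s with h1 | h1
      · simp [distFun_of_neg hZ0 (h1.trans_lt hs)]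
      · simp [h1]
    · filter_upwards [Measure.ae_ne volume (0 : ℝ)] with v hv hv'
      rw [distFun_of_neg hZ0 (lt_of_le_of_ne hv'.2 hv)]
      simp

/-- The forward equation: adding an independent exponential variable to a variable with continuous
distribution function gives a differentiable distribution function. -/
theorem hasDerivAt_distFun_add_exp [IsProbabilityMeasure P] {Z V : Ω → ℝ} {r : ℝ}
    (hr : 0 < r) (hZ : Measurable Z)
    (hZ0 : ∀ᵐ ω ∂P, 0 ≤ Z ω) (hVm : Measurable V) (hV : HasLaw V (expMeasure r) P)
    (h : IndepFun Z V P) (hC : Continuous (distFun P Z)) (s : ℝ) :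
    HasDerivAt (distFun P fun ω => Z ω + V ω)
      (r * (distFun P Z s - distFun P (fun ω => Z ω + V ω) s)) s := by
  have e : distFun P (fun ω => Z ω + V ω) = fun s =>
      r * Real.exp (-(r * s)) * ∫ v in (0 : ℝ)..s, Real.exp (r * v) * distFun P Z v := by
    ext s; exact distFun_add_exp hr hZ hZ0 hVm hV h s
  rw [e]
  have hc : Continuous fun v => Real.exp (r * v) * distFun P Z v := by fun_prop
  have d1 := intervalIntegral.integral_hasDerivAt_right (hc.intervalIntegrable 0 s)
    (hc.stronglyMeasurableAtFilter _ _) hc.continuousAt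
  have d2 : HasDerivAt (fun s => r * Real.exp (-(r * s)))
      (r * (Real.exp (-(r * s)) * (-(r * 1)))) s :=
    (((hasDerivAt_id s).const_mul r).neg.exp).const_mul r
  refine (d2.mul d1).congr_deriv ?_
  have : Real.exp (-(r * s)) * Real.exp (r * s) = 1 := by rw [← Real.exp_add]; simp
  linear_combination (r * distFun P Z s) * this

end OneDim

end PolyaUrn

namespace PolyaUrn

/-! ### Sample paths: jump times, first explosion and final numbers -/

section Pathwise

/-- The time `τ m + ⋯ + τ k` at which the birth process jumps from `k` to `k + 1`. -/
noncomputable def birthTime (m : ℕ) (τ : ℕ → ℝ) (k : ℕ) : ℝ≥0∞ :=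
  ∑ l ∈ Finset.Icc m k, ENNReal.ofReal (τ l)

theorem birthTime_mono (m : ℕ) (τ : ℕ → ℝ) : Monotone (birthTime m τ) := fun _ _ h =>
  Finset.sum_le_sum_of_subset (Finset.Icc_subset_Icc_right h)

theorem birthTime_lt_top (m : ℕ) (τ : ℕ → ℝ) (k : ℕ) : birthTime m τ k < ∞ :=
  ENNReal.sum_lt_top.2 fun _ _ => ENNReal.ofReal_lt_top

/-- Birth times are monotone in the level, so the infimum becomes a single threshold. This also
covers the value `∞`. -/
theorem birthProcess_le_iff (m : ℕ) (τ : ℕ → ℝ) (t : ℝ≥0∞) (k : ℕ) :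
    birthProcess m τ t ≤ k ↔ t < birthTime m τ k := by
  constructor
  · intro h
    have hne : ((fun k : ℕ => (k : ℕ∞)) ''
        {k | t < ∑ l ∈ Finset.Icc m k, ENNReal.ofReal (τ l)}).Nonempty := by
      by_contra hemp
      rw [Set.not_nonempty_iff_eq_empty] at hemp
      rw [birthProcess, hemp, sInf_empty] at h
      exact absurd h (by simp)
    obtain ⟨j, hj, hj'⟩ := csInf_mem hne
    have : j ≤ k := by
      rw [birthProcess, ← hj'] at h
      exact ENat.natCast_le_natCast.1 h
    exact lt_of_lt_of_le hj (birthTime_mono m τ this)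
  · intro h
    exact sInf_le ⟨k, h, rfl⟩

theorem birthTime_eq_sum_range (m : ℕ) (τ : ℕ → ℝ) (k : ℕ) :
    birthTime m τ (m + k) = ∑ j ∈ Finset.range (k + 1), ENNReal.ofReal (τ (m + j)) := by
  rw [birthTime, Finset.range_eq_Ico, Finset.sum_Ico_add (fun l => ENNReal.ofReal (τ l)),
    ← Finset.Ico_add_one_right_eq_Icc]
  simp [add_assoc, add_comm]

theorem birthTime_le_explosionTime (m : ℕ) (τ : ℕ → ℝ) (k : ℕ) :
    birthTime m τ k ≤ explosionTime m τ := by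
  refine (birthTime_mono m τ (Nat.le_add_left k m)).trans ?_
  rw [birthTime_eq_sum_range]
  exact ENNReal.sum_le_tsum _

theorem birthTime_lt_explosionTime {m : ℕ} {τ : ℕ → ℝ} (hτ : ∀ k ≥ m, 0 < τ k) (k : ℕ) :
    birthTime m τ k < explosionTime m τ := by
  refine lt_of_le_of_lt (birthTime_mono m τ (Nat.le_add_left k m)) ?_
  refine lt_of_lt_of_le ?_ (birthTime_le_explosionTime m τ (m + (k + 1)))
  rw [birthTime_eq_sum_range m τ (k + 1), Finset.sum_range_succ, ← birthTime_eq_sum_range]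
  exact ENNReal.lt_add_right (birthTime_lt_top _ _ _).ne
    (by simpa using hτ (m + (k + 1)) (by omega))

theorem exists_lt_birthTime {m : ℕ} {τ : ℕ → ℝ} {t : ℝ≥0∞} (h : t < explosionTime m τ) :
    ∃ k, t < birthTime m τ k := by
  rw [explosionTime, ENNReal.tsum_eq_iSup_nat] at h
  obtain ⟨n, hn⟩ := lt_iSup_iff.1 h
  refine ⟨m + n, lt_of_lt_of_le hn ?_⟩
  rw [birthTime_eq_sum_range]
  exact Finset.sum_le_sum_of_subset (Finset.range_subset_range.2 (Nat.le_succ n))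

theorem birthProcess_ne_top {m : ℕ} {τ : ℕ → ℝ} {t : ℝ≥0∞} (h : t < explosionTime m τ) :
    birthProcess m τ t ≠ ⊤ := by
  obtain ⟨k, hk⟩ := exists_lt_birthTime h
  exact ne_top_of_le_ne_top (ENat.natCast_ne_top k) ((birthProcess_le_iff m τ t k).2 hk)

variable {ι : Type*} {m : ι → ℕ} {τ : ι → ℕ → ℝ}

theorem combinedProcess_mono (m : ι → ℕ) (τ : ι → ℕ → ℝ) : Monotone (combinedProcess m τ) :=
  fun _ _ h i => birthProcess_mono (m i) (τ i) h

variable [Finite ι] [Nonempty ι]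

/-- The colour `j` that explodes first always has a further birth ahead of it, strictly before its
explosion, and the next jump comes no later than that birth. -/
theorem jumpTime_lt (hτ : ∀ i, ∀ k ≥ m i, 0 < τ i k) (n : ℕ) :
    jumpTime m τ n < ⨅ i, explosionTime (m i) (τ i) := by
  obtain ⟨j, hj⟩ := exists_eq_ciInf_of_finite (f := fun i => explosionTime (m i) (τ i))
  rw [← hj]
  induction n with
  | zero => exact lt_of_le_of_lt (zero_le) (birthTime_lt_explosionTime (hτ j) (m j))
  | succ n ih =>
    obtain ⟨k, hk⟩ := ENat.ne_top_iff_exists.1 (birthProcess_ne_top ih)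
    have h1 : jumpTime m τ n < birthTime (m j) (τ j) k :=
      (birthProcess_le_iff _ _ _ _).1 hk.symm.le
    refine lt_of_le_of_lt ?_ (birthTime_lt_explosionTime (hτ j) k)
    rw [jumpTime]
    refine sInf_le ⟨h1, fun heq => ?_⟩
    have h2 := congrFun heq j
    simp only [combinedProcess] at h2
    rw [← hk] at h2
    exact lt_irrefl _ ((birthProcess_le_iff _ _ _ _).1 h2.le)

/-- Before the first explosion the combined process is right-continuous. -/
theorem exists_combinedProcess_eq {t : ℝ≥0∞} (ht : t < ⨅ i, explosionTime (m i) (τ i)) :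
    ∃ u > t, ∀ s, t ≤ s → s < u → combinedProcess m τ s = combinedProcess m τ t := by
  have h1 : ∀ i, ∃ k : ℕ, (k : ℕ∞) = birthProcess (m i) (τ i) t := fun i =>
    ENat.ne_top_iff_exists.1 (birthProcess_ne_top (ht.trans_le (iInf_le _ i)))
  choose k hk using h1
  obtain ⟨j, hj⟩ := exists_eq_ciInf_of_finite (f := fun i => birthTime (m i) (τ i) (k i))
  refine ⟨⨅ i, birthTime (m i) (τ i) (k i), ?_, fun s hs hsu => ?_⟩
  · rw [← hj]
    exact (birthProcess_le_iff _ _ _ _).1 (hk j).symm.le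
  · refine le_antisymm (fun i => ?_) (combinedProcess_mono m τ hs)
    simp only [combinedProcess]
    rw [← hk i]
    exact (birthProcess_le_iff _ _ _ _).2 (hsu.trans_le (iInf_le _ i))

theorem combinedProcess_jumpTime_succ_ne (hτ : ∀ i, ∀ k ≥ m i, 0 < τ i k) (n : ℕ) :
    combinedProcess m τ (jumpTime m τ (n + 1)) ≠ combinedProcess m τ (jumpTime m τ n) := by
  intro heq
  obtain ⟨u, hu, hc⟩ := exists_combinedProcess_eq (jumpTime_lt hτ (n + 1))
  have : u ≤ jumpTime m τ (n + 1) := by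
    conv_rhs => rw [jumpTime]
    refine le_sInf fun t ht => ?_
    by_contra hlt
    rw [not_le] at hlt
    rcases le_or_gt (jumpTime m τ (n + 1)) t with h | h
    · exact ht.2 ((hc t h hlt).trans heq)
    · rw [jumpTime] at h
      exact absurd (sInf_le ht) (not_le.2 h)
  exact absurd hu (not_lt.2 this)

/-- Before the first explosion all counts are finite, while every jump raises the total count by at
least one. Infinitely many jumps up to time `s` are therefore impossible. -/
theorem exists_lt_jumpTime (hτ : ∀ i, ∀ k ≥ m i, 0 < τ i k) {s : ℝ≥0∞}
    (hs : s < ⨅ i, explosionTime (m i) (τ i)) : ∃ n, s < jumpTime m τ n := by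
  by_contra! hcon
  have := Fintype.ofFinite ι
  have hfin : ∀ i t, t ≤ s → birthProcess (m i) (τ i) t ≠ ⊤ := fun i t ht =>
    birthProcess_ne_top ((ht.trans_lt hs).trans_le (iInf_le _ i))
  let N : ℕ → ℕ := fun n => ∑ i, (birthProcess (m i) (τ i) (jumpTime m τ n)).toNat
  have hle : ∀ i {t u}, t ≤ u → u ≤ s →
      (birthProcess (m i) (τ i) t).toNat ≤ (birthProcess (m i) (τ i) u).toNat :=
    fun i t u htu hus => ENat.toNat_le_toNat (birthProcess_mono _ _ htu) (hfin i u hus)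
  have hmono : StrictMono N := by
    refine strictMono_nat_of_lt_succ fun n => ?_
    have hj := jumpTime_mono m τ (Nat.le_succ n)
    obtain ⟨i, hi⟩ := Function.ne_iff.1 (combinedProcess_jumpTime_succ_ne hτ n)
    refine Finset.sum_lt_sum (fun i _ => hle i hj (hcon _)) ⟨i, Finset.mem_univ i, ?_⟩
    refine lt_of_le_of_ne (hle i hj (hcon _)) fun h => hi ?_
    simp only [combinedProcess]
    rw [← ENat.natCast_toNat (hfin i _ (hcon (n + 1))), ← ENat.natCast_toNat (hfin i _ (hcon n)), h]
  have hb : ∀ n, N n ≤ ∑ i, (birthProcess (m i) (τ i) s).toNat := fun n =>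
    Finset.sum_le_sum fun i _ => hle i (hcon n) le_rfl
  -- A strictly increasing sequence of naturals dominates its index; taking the index one above the
  -- bound gives the contradiction.
  have h1 := hmono.le_apply (x := ∑ i, (birthProcess (m i) (τ i) s).toNat + 1)
  have h2 := hb (∑ i, (birthProcess (m i) (τ i) s).toNat + 1)
  omega

theorem urnLimit_le_iff (hτ : ∀ i, ∀ k ≥ m i, 0 < τ i k) (i : ι) (k : ℕ) :
    urnLimit m τ i ≤ k ↔ ⨅ j, explosionTime (m j) (τ j) ≤ birthTime (m i) (τ i) k := by
  simp only [urnLimit, iSup_le_iff, urn, combinedProcess, birthProcess_le_iff]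
  constructor
  · intro h
    by_contra hlt
    obtain ⟨n, hn⟩ := exists_lt_jumpTime hτ (not_le.1 hlt)
    exact absurd (h n) (not_lt.2 hn.le)
  · exact fun h n => (jumpTime_lt hτ n).trans_le h

theorem urnLimit_eq_iff (hτ : ∀ i, ∀ k ≥ m i, 0 < τ i k) (i : ι) (k : ℕ) :
    urnLimit m τ i = (k + 1 : ℕ) ↔ birthTime (m i) (τ i) k < ⨅ j, explosionTime (m j) (τ j) ∧
      ⨅ j, explosionTime (m j) (τ j) ≤ birthTime (m i) (τ i) (k + 1) := by
  rw [← not_le, ← urnLimit_le_iff hτ, ← urnLimit_le_iff hτ, not_le]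
  constructor
  · intro h
    rw [h]
    exact ⟨by exact_mod_cast Nat.lt_succ_self k, le_rfl⟩
  · rintro ⟨h1, h2⟩
    refine le_antisymm h2 ?_
    push_cast
    exact Order.add_one_le_of_lt h1

/-- If all colours `e l` have finite final numbers, the first explosion is among the others. -/
theorem forall_urnLimit_eq_iff {κ : Type*} (hτ : ∀ i, ∀ k ≥ m i, 0 < τ i k)
    (e : κ → ι) (k : κ → ℕ) :
    (∀ l, urnLimit m τ (e l) = (k l + 1 : ℕ)) ↔
      ∀ l, birthTime (m (e l)) (τ (e l)) (k l) <
          ⨅ j, ⨅ _ : j ∉ Set.range e, explosionTime (m j) (τ j) ∧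
        ⨅ j, ⨅ _ : j ∉ Set.range e, explosionTime (m j) (τ j) ≤
          birthTime (m (e l)) (τ (e l)) (k l + 1) := by
  simp only [urnLimit_eq_iff hτ]
  -- Under either set of upper bounds the first explosion lies outside the range of `e`: a colour `e
  -- l` exploding first would do so no later than one of its own births, and an outside minimum
  -- preceding such births also precedes the explosions of all `e l`.
  have key : (∀ l, ⨅ j, explosionTime (m j) (τ j) ≤ birthTime (m (e l)) (τ (e l)) (k l + 1)) ∨
      (∀ l, ⨅ j, ⨅ _ : j ∉ Set.range e, explosionTime (m j) (τ j) ≤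
          birthTime (m (e l)) (τ (e l)) (k l + 1)) →
      ⨅ j, explosionTime (m j) (τ j) =
        ⨅ j, ⨅ _ : j ∉ Set.range e, explosionTime (m j) (τ j) := by
    have hle : ⨅ j, explosionTime (m j) (τ j) ≤
        ⨅ j, ⨅ _ : j ∉ Set.range e, explosionTime (m j) (τ j) :=
      le_iInf fun j => le_iInf fun _ => iInf_le _ j
    rintro (h | h)
    · refine le_antisymm hle ?_
      obtain ⟨j, hj⟩ := exists_eq_ciInf_of_finite (f := fun i => explosionTime (m i) (τ i))
      have hjr : j ∉ Set.range e := by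
        rintro ⟨l, rfl⟩
        exact absurd (hj.trans_le (h l)) (not_le.2 (birthTime_lt_explosionTime (hτ _) _))
      exact (iInf₂_le j hjr).trans hj.le
    · refine le_antisymm hle (le_iInf fun j => ?_)
      by_cases hjr : j ∈ Set.range e
      · obtain ⟨l, rfl⟩ := hjr
        exact (h l).trans (birthTime_lt_explosionTime (hτ _) _).le
      · exact iInf₂_le j hjr
  constructor
  · intro h
    rw [← key (Or.inl fun l => (h l).2)]
    exact h
  · intro h
    rw [key (Or.inr fun l => (h l).2)]
    exact h

end Pathwise

end PolyaUrn

namespace PolyaUrn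

/-! ### One colour: densities of birth times and of the explosion time -/

section OneColour

variable {Ω : Type*} [MeasurableSpace Ω] {P : Measure Ω}

theorem indepFun_restrict_of_disjoint {ι : Type*} {β : ι → Type*}
    [∀ i, MeasurableSpace (β i)] {f : (i : ι) → Ω → β i} (h : iIndepFun f P)
    (hf : ∀ i, Measurable (f i)) {S T : Set ι} (hST : Disjoint S T) :
    IndepFun (fun ω (i : S) => f i ω) (fun ω (i : T) => f i ω) P := by
  have key : ∀ S : Set ι, MeasurableSpace.comap (fun ω (i : S) => f i ω) MeasurableSpace.pi =
      ⨆ i ∈ S, MeasurableSpace.comap (f i) inferInstance := by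
    intro S
    rw [MeasurableSpace.pi, MeasurableSpace.comap_iSup, iSup_subtype']
    simp only [MeasurableSpace.comap_comp]
    rfl
  rw [IndepFun_iff_Indep, key, key]
  exact indep_iSup_of_disjoint (fun i => (hf i).comap_le) h.iIndep hST

theorem integral_pos_of_ae_pos [IsProbabilityMeasure P] {f : Ω → ℝ} (hf : Integrable f P)
    (h : ∀ᵐ ω ∂P, 0 < f ω) : 0 < ∫ ω, f ω ∂P := by
  have h0 : 0 ≤ᵐ[P] f := h.mono fun ω hω => hω.le
  refine lt_of_le_of_ne (integral_nonneg_of_ae h0) fun heq => ?_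
  have h1 := (integral_eq_zero_iff_of_nonneg_ae h0 hf).1 heq.symm
  have h2 : ∀ᵐ _ω ∂P, False := by
    filter_upwards [h, h1] with ω ha hb
    exact ha.ne' hb
  exact IsProbabilityMeasure.ne_zero P (by simpa using h2)

theorem lintegral_exp {V : Ω → ℝ} {r : ℝ} [IsProbabilityMeasure P] (hr : 0 < r)
    (hVm : Measurable V) (hV : HasLaw V (expMeasure r) P) :
    ∫⁻ ω, ENNReal.ofReal (V ω) ∂P = ENNReal.ofReal (1 / r) := by
  have h0 : 0 ≤ᵐ[P] V := (ae_pos_exp hr hV).mono fun ω hω => hω.le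
  rw [lintegral_eq_lintegral_meas_lt P h0 hVm.aemeasurable]
  have h1 : ∀ t ∈ Set.Ioi (0 : ℝ), P {ω | t < V ω} = ENNReal.ofReal (Real.exp (-r * t)) := by
    intro t ht
    have h2 : {ω | t < V ω} = {ω | V ω ≤ t}ᶜ := by ext; simp
    have h3 := distFun_exp hr hV t
    rw [if_pos (le_of_lt ht), distFun] at h3
    rw [← ofReal_measureReal, h2, measureReal_compl (measurableSet_le hVm measurable_const), h3]
    simp
  rw [setLIntegral_congr_fun measurableSet_Ioi h1, ← ofReal_integral_eq_lintegral_ofReal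
    (exp_neg_integrableOn_Ioi 0 hr) (ae_of_all _ fun _ => (Real.exp_pos _).le),
    integral_exp_mul_Ioi (by linarith)]
  simp

/-- A sequence of independent exponential variables with rates `r k`. -/
structure IsExpSeq (P : Measure Ω) (σ : ℕ → Ω → ℝ) (r : ℕ → ℝ) : Prop where
  pos : ∀ k, 0 < r k
  meas : ∀ k, Measurable (σ k)
  law : ∀ k, HasLaw (σ k) (expMeasure (r k)) P
  indep : iIndepFun σ P

/-- The sum of the first `n` terms of `σ`. -/
noncomputable def partialSum {Ω : Type*} (σ : ℕ → Ω → ℝ) (n : ℕ) (ω : Ω) : ℝ :=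
  ∑ j ∈ Finset.range n, σ j ω

/-- The density of the sum of the first `n + 2` terms of `σ`. -/
noncomputable def sumDensity (P : Measure Ω) (σ : ℕ → Ω → ℝ) (r : ℕ → ℝ) (n : ℕ) (s : ℝ) : ℝ :=
  r (n + 1) * (distFun P (partialSum σ (n + 1)) s - distFun P (partialSum σ (n + 2)) s)

theorem partialSum_succ {Ω : Type*} (σ : ℕ → Ω → ℝ) (n : ℕ) :
    partialSum σ (n + 1) = fun ω => partialSum σ n ω + σ n ω := by
  ext ω; exact Finset.sum_range_succ _ _

theorem measurable_explosionTime {σ : ℕ → Ω → ℝ} (m : ℕ) (hσ : ∀ k ≥ m, Measurable (σ k)) :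
    Measurable fun ω => explosionTime m fun k => σ k ω :=
  Measurable.tsum fun k => (hσ (m + k) (Nat.le_add_right m k)).ennreal_ofReal

theorem explosionTime_eq_add (m : ℕ) (σ : ℕ → ℝ) :
    explosionTime m σ = ENNReal.ofReal (σ m) + explosionTime (m + 1) σ := by
  rw [explosionTime, tsum_eq_zero_add' ENNReal.summable, explosionTime]
  simp only [add_zero]
  congr 2 with k
  rw [add_right_comm, add_assoc]

namespace IsExpSeq

variable {σ : ℕ → Ω → ℝ} {r : ℕ → ℝ}

theorem measurable_partialSum (h : IsExpSeq P σ r) (n : ℕ) : Measurable (partialSum σ n) :=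
  Finset.measurable_sum _ fun j _ => h.meas j

theorem indepFun_partialSum (h : IsExpSeq P σ r) (n : ℕ) :
    IndepFun (partialSum σ n) (σ n) P := by
  have := h.indep.indepFun_finsetSum_of_notMem h.meas (Finset.notMem_range_self (n := n))
  convert this using 1
  ext ω
  simp [partialSum]

/-- The first `N` terms are independent of the later ones. -/
theorem indepFun_tail (h : IsExpSeq P σ r) (N : ℕ) :
    IndepFun (fun ω (i : Set.Iio N) => σ i ω) (fun ω (i : Set.Ici N) => σ i ω) P :=
  indepFun_restrict_of_disjoint h.indep h.meas (Set.Iio_disjoint_Ici le_rfl)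

variable [IsProbabilityMeasure P]

theorem ae_pos (h : IsExpSeq P σ r) : ∀ᵐ ω ∂P, ∀ k, 0 < σ k ω :=
  ae_all_iff.2 fun k => ae_pos_exp (h.pos k) (h.law k)

theorem partialSum_nonneg (h : IsExpSeq P σ r) (n : ℕ) : ∀ᵐ ω ∂P, 0 ≤ partialSum σ n ω := by
  filter_upwards [h.ae_pos] with ω hω
  exact Finset.sum_nonneg fun j _ => (hω j).le

/-- Supplies the continuity needed by the forward equation. A single exponential has a kink at `0`,
so differentiability is available only from two terms on. -/
theorem distFun_partialSum_continuous (h : IsExpSeq P σ r) (n : ℕ) :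
    Continuous (distFun P (partialSum σ (n + 1))) := by
  induction n with
  | zero =>
    have : partialSum σ (0 + 1) = σ 0 := by ext; simp [partialSum]
    rw [this]
    exact distFun_exp_continuous (h.pos 0) (h.law 0)
  | succ n ih =>
    rw [partialSum_succ]
    exact continuous_iff_continuousAt.2 fun s =>
      (hasDerivAt_distFun_add_exp (h.pos _) (h.measurable_partialSum _) (h.partialSum_nonneg _)
        (h.meas _) (h.law _) (h.indepFun_partialSum _) ih s).continuousAt

theorem hasDerivAt_distFun_partialSum (h : IsExpSeq P σ r) (n : ℕ) (s : ℝ) :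
    HasDerivAt (distFun P (partialSum σ (n + 2))) (sumDensity P σ r n s) s := by
  rw [sumDensity, partialSum_succ σ (n + 1)]
  exact hasDerivAt_distFun_add_exp (h.pos _) (h.measurable_partialSum _) (h.partialSum_nonneg _)
    (h.meas _) (h.law _) (h.indepFun_partialSum _) (h.distFun_partialSum_continuous _) s

theorem sumDensity_continuous (h : IsExpSeq P σ r) (n : ℕ) :
    Continuous (sumDensity P σ r n) :=
  continuous_const.mul
    ((h.distFun_partialSum_continuous n).sub (h.distFun_partialSum_continuous (n + 1)))

theorem distFun_partialSum_succ_le (h : IsExpSeq P σ r) (n : ℕ) (s : ℝ) :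
    distFun P (partialSum σ (n + 1)) s ≤ distFun P (partialSum σ n) s := by
  refine ENNReal.toReal_mono (measure_ne_top _ _) (measure_mono_ae ?_)
  filter_upwards [h.ae_pos] with ω hω hs
  rw [partialSum_succ] at hs
  exact le_trans (le_add_of_nonneg_right (hω n).le) hs

theorem sumDensity_nonneg (h : IsExpSeq P σ r) (n : ℕ) (s : ℝ) : 0 ≤ sumDensity P σ r n s :=
  mul_nonneg (h.pos _).le (sub_nonneg.2 (h.distFun_partialSum_succ_le _ _))

theorem abs_sumDensity_zero_le (h : IsExpSeq P σ r) (s : ℝ) : |sumDensity P σ r 0 s| ≤ r 1 := by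
  rw [abs_of_nonneg (h.sumDensity_nonneg 0 s)]
  refine mul_le_of_le_one_right (h.pos _).le ?_
  have := distFun_le_one (P := P) (partialSum σ (0 + 1)) s
  have := distFun_nonneg (P := P) (partialSum σ (0 + 2)) s
  linarith

/-- The difference of distribution functions is the mean of `distFun P (σ 0) s - distFun P (σ 0) (s
- σ 1)`, which is positive since the exponential distribution function increases strictly on `[0,
∞)`. -/
theorem sumDensity_zero_pos (h : IsExpSeq P σ r) {s : ℝ} (hs : 0 < s) :
    0 < sumDensity P σ r 0 s := by
  refine mul_pos (h.pos _) ?_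
  have h1 : partialSum σ (0 + 1) = σ 0 := by ext; simp [partialSum]
  have hC : Measurable (distFun P (σ 0)) := (distFun_mono _).measurable
  have hi : Integrable (fun ω => distFun P (σ 0) (s - σ 1 ω)) P := by
    refine integrable_of_measurable_of_bound (hC.comp (measurable_const.sub (h.meas 1))) 1
      fun ω => ?_
    rw [abs_of_nonneg (distFun_nonneg _ _)]
    exact distFun_le_one _ _
  rw [partialSum_succ σ (0 + 1), h1, distFun_add (h.meas _) (h.meas _)
    (h.indep.indepFun (by decide))]
  have h2 : distFun P (σ 0) s - ∫ ω, distFun P (σ 0) (s - σ (0 + 1) ω) ∂P =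
      ∫ ω, (distFun P (σ 0) s - distFun P (σ 0) (s - σ 1 ω)) ∂P := by
    rw [integral_sub (integrable_const _) hi]; simp
  rw [h2]
  refine integral_pos_of_ae_pos ((integrable_const _).sub hi) ?_
  filter_upwards [h.ae_pos] with ω hω
  rw [sub_pos, distFun_exp (h.pos 0) (h.law 0), distFun_exp (h.pos 0) (h.law 0), if_pos hs.le]
  have h3 := mul_pos (h.pos 0) hs
  have h4 := mul_pos (h.pos 0) (hω 1)
  split_ifs with h5
  · have : Real.exp (-(r 0 * s)) < Real.exp (-(r 0 * (s - σ 1 ω))) :=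
      Real.exp_lt_exp.2 (by nlinarith)
    linarith
  · have : Real.exp (-(r 0 * s)) < 1 := Real.exp_lt_one_iff.2 (by linarith)
    linarith

/-- Two terms suffice for a bounded density, and `φ` may be any measurable function of the rest.
Finite sums and the infinite tail thus get densities of the same form, which makes them comparable.
-/
theorem hasDerivAt_distFun_two_add (h : IsExpSeq P σ r) {φ : (Set.Ici 2 → ℝ) → ℝ}
    (hφ : Measurable φ) (s : ℝ) :
    HasDerivAt (distFun P fun ω => partialSum σ 2 ω + φ fun i => σ i ω)
      (∫ ω, sumDensity P σ r 0 (s - φ fun i => σ i ω) ∂P) s := by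
  have hm : Measurable fun ω (i : Set.Ici 2) => σ i ω := measurable_pi_lambda _ fun i => h.meas i
  have hi : IndepFun (partialSum σ 2) (fun ω => φ fun i : Set.Ici 2 => σ i ω) P := by
    have := (h.indepFun_tail 2).comp
      (φ := fun y : Set.Iio 2 → ℝ => y ⟨0, by simp⟩ + y ⟨1, by simp⟩) (ψ := φ) (by fun_prop) hφ
    have e : partialSum σ 2 = fun ω => σ 0 ω + σ 1 ω := by
      ext ω
      simp [partialSum, Finset.sum_range_succ]
    rw [e]
    exact this
  exact hasDerivAt_distFun_add (h.measurable_partialSum 2) (hφ.comp hm) hi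
    h.abs_sumDensity_zero_le (h.hasDerivAt_distFun_partialSum 0) s

/-- Uniqueness of derivatives identifies the forward-equation density with the convolution density.
The former gives probabilities, the latter gives bounds and limits. -/
theorem sumDensity_eq_integral (h : IsExpSeq P σ r) (n : ℕ) (s : ℝ) :
    sumDensity P σ r n s =
      ∫ ω, sumDensity P σ r 0 (s - ∑ j ∈ Finset.range n, σ (2 + j) ω) ∂P := by
  have h1 := h.hasDerivAt_distFun_two_add
    (φ := fun y => ∑ j ∈ Finset.range n, y ⟨2 + j, by simp⟩) (by fun_prop) s
  have h2 : (fun ω => partialSum σ 2 ω + ∑ j ∈ Finset.range n, σ (2 + j) ω) =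
      partialSum σ (n + 2) := by
    ext ω
    rw [add_comm n 2, partialSum, partialSum, Finset.sum_range_add]
  simp only [h2] at h1
  exact (h.hasDerivAt_distFun_partialSum n s).unique h1

theorem abs_sumDensity_le (h : IsExpSeq P σ r) (n : ℕ) (s : ℝ) :
    |sumDensity P σ r n s| ≤ r 1 := by
  rw [h.sumDensity_eq_integral]
  have := norm_integral_le_of_norm_le_const (μ := P) (C := r 1)
    (f := fun ω => sumDensity P σ r 0 (s - ∑ j ∈ Finset.range n, σ (2 + j) ω))
    (ae_of_all _ fun ω => h.abs_sumDensity_zero_le _)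
  simpa using this

/-- The explosion time has finite mean `∑ 1 / r k`. -/
theorem ae_explosionTime_lt_top (h : IsExpSeq P σ r) (hr : Summable fun k => 1 / r k) :
    ∀ᵐ ω ∂P, explosionTime 0 (fun k => σ k ω) < ∞ := by
  refine ae_lt_top (measurable_explosionTime 0 fun k _ => h.meas k) ?_
  simp only [explosionTime, zero_add]
  rw [lintegral_tsum fun k => (h.meas k).ennreal_ofReal.aemeasurable]
  simp only [lintegral_exp (h.pos _) (h.meas _) (h.law _)]
  exact hr.tsum_ofReal_ne_top

theorem explosionTime_ne_top_of_zero {τ : ℕ → ℝ} (h : explosionTime 0 τ < ∞) (N : ℕ) :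
    explosionTime N τ < ∞ := by
  induction N with
  | zero => exact h
  | succ N ih =>
    rw [explosionTime_eq_add] at ih
    exact lt_of_le_of_lt le_add_self ih

/-- Some far tail is small with positive probability; the finitely many omitted terms are put back
one at a time, each being independently small with positive probability. -/
theorem measure_explosionTime_lt_pos (h : IsExpSeq P σ r) (hr : Summable fun k => 1 / r k)
    (N : ℕ) {ε : ℝ} (hε : 0 < ε) :
    0 < P {ω | explosionTime N (fun k => σ k ω) < ENNReal.ofReal ε} := by
  have step : ∀ N (ε ε' : ℝ), 0 < ε → ε < ε' →
      0 < P {ω | explosionTime (N + 1) (fun k => σ k ω) < ENNReal.ofReal ε} →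
      0 < P {ω | explosionTime N (fun k => σ k ω) < ENNReal.ofReal ε'} := by
    intro N ε ε' h0 hlt hpos
    have hi : IndepFun (σ N) (fun ω => explosionTime (N + 1) (fun k => σ k ω)) P := by
      have hφ : Measurable fun y : Set.Iio (N + 1) → ℝ => y ⟨N, Nat.lt_succ_self N⟩ :=
        measurable_pi_apply _
      have hψ : Measurable fun y : Set.Ici (N + 1) → ℝ =>
          ∑' k : ℕ, ENNReal.ofReal (y ⟨N + 1 + k, by simp⟩) :=
        Measurable.tsum fun k => by fun_prop
      exact (h.indepFun_tail (N + 1)).comp hφ hψ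
    have h1 := hi.measure_inter_preimage_eq_mul (Set.Iic (ε' - ε)) (Set.Iio (ENNReal.ofReal ε))
      measurableSet_Iic measurableSet_Iio
    have h2 : 0 < P (σ N ⁻¹' Set.Iic (ε' - ε)) := by
      have h3 := distFun_exp (h.pos N) (h.law N) (ε' - ε)
      rw [if_pos (by linarith)] at h3
      have h4 : 0 < distFun P (σ N) (ε' - ε) := by
        rw [h3, sub_pos]
        exact Real.exp_lt_one_iff.2 (by nlinarith [mul_pos (h.pos N) (sub_pos.2 hlt)])
      exact (ENNReal.toReal_pos_iff.1 h4).1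
    have h5 : 0 < P (σ N ⁻¹' Set.Iic (ε' - ε) ∩
        (fun ω => explosionTime (N + 1) (fun k => σ k ω)) ⁻¹' Set.Iio (ENNReal.ofReal ε)) := by
      rw [h1]
      exact ENNReal.mul_pos h2.ne' hpos.ne'
    refine h5.trans_le (measure_mono ?_)
    rintro ω ⟨ha, hb⟩
    have hb' : explosionTime (N + 1) (fun k => σ k ω) < ENNReal.ofReal ε := hb
    have ha' : ENNReal.ofReal (σ N ω) ≤ ENNReal.ofReal (ε' - ε) := ENNReal.ofReal_le_ofReal ha
    change explosionTime N (fun k => σ k ω) < ENNReal.ofReal ε'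
    rw [explosionTime_eq_add]
    calc _ < ENNReal.ofReal (ε' - ε) + ENNReal.ofReal ε :=
          ENNReal.add_lt_add_of_le_of_lt (ne_top_of_le_ne_top ENNReal.ofReal_ne_top ha') ha' hb'
      _ = ENNReal.ofReal ε' := by
          rw [← ENNReal.ofReal_add (by linarith) h0.le]; congr 1; ring
  have steps : ∀ d (ε ε' : ℝ), 0 < ε → ε < ε' →
      0 < P {ω | explosionTime (N + d) (fun k => σ k ω) < ENNReal.ofReal ε} →
      0 < P {ω | explosionTime N (fun k => σ k ω) < ENNReal.ofReal ε'} := by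
    intro d
    induction d with
    | zero =>
      intro ε ε' h0 hlt hpos
      exact hpos.trans_le (measure_mono fun ω (hω : _ < _) =>
        lt_of_lt_of_le hω (ENNReal.ofReal_le_ofReal hlt.le))
    | succ d ih =>
      intro ε ε' h0 hlt hpos
      obtain ⟨δ, h1, h2⟩ := exists_between hlt
      exact ih δ ε' (h0.trans h1) h2 (step (N + d) ε δ h0 h1 hpos)
  -- Tails of an almost surely convergent series tend to `0`, so they cannot all stay above `ε / 2`
  -- almost surely.
  have hex : ∃ d, 0 < P {ω | explosionTime (N + d) (fun k => σ k ω) < ENNReal.ofReal (ε / 2)} := by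
    by_contra! hcon
    have h1 : ∀ᵐ ω ∂P, ∀ d, ENNReal.ofReal (ε / 2) ≤ explosionTime (N + d) (fun k => σ k ω) := by
      refine ae_all_iff.2 fun d => ?_
      rw [ae_iff]
      simpa using hcon d
    have h2 : ∀ᵐ _ω ∂P, False := by
      filter_upwards [h1, h.ae_explosionTime_lt_top hr] with ω ha hb
      have h3 := explosionTime_ne_top_of_zero hb N
      have h4 := ENNReal.tendsto_sum_nat_add (fun k => ENNReal.ofReal (σ (N + k) ω)) h3.ne
      have h5 : ∀ d, ENNReal.ofReal (ε / 2) ≤ ∑' k, ENNReal.ofReal (σ (N + (k + d)) ω) := by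
        intro d
        refine (ha d).trans_eq ?_
        rw [explosionTime]
        simp only [add_assoc, add_comm d]
      have h6 := ge_of_tendsto' h4 h5
      simp only [nonpos_iff_eq_zero, ENNReal.ofReal_eq_zero] at h6
      linarith
    exact IsProbabilityMeasure.ne_zero P (by simpa using h2)
  obtain ⟨d, hd⟩ := hex
  exact steps d (ε / 2) ε (by linarith) (by linarith) hd

theorem timeCDF_eq_distFun (h : IsExpSeq P σ r) (hr : Summable fun k => 1 / r k) :
    timeCDF P (fun ω => explosionTime 0 fun k => σ k ω) =
      distFun P fun ω => partialSum σ 2 ω + (explosionTime 2 fun k => σ k ω).toReal := by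
  ext s
  refine measureReal_congr ?_
  filter_upwards [h.ae_pos, h.ae_explosionTime_lt_top hr] with ω hω hT
  have h2 := explosionTime_ne_top_of_zero hT 2
  have h3 : explosionTime 0 (fun k => σ k ω) =
      ENNReal.ofReal (partialSum σ 2 ω + (explosionTime 2 fun k => σ k ω).toReal) := by
    have h4 : 0 ≤ partialSum σ 2 ω := Finset.sum_nonneg fun j _ => (hω j).le
    rw [ENNReal.ofReal_add h4 ENNReal.toReal_nonneg, ENNReal.ofReal_toReal h2.ne,
      explosionTime_eq_add, explosionTime_eq_add, ← add_assoc]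
    simp only [partialSum, Finset.sum_range_succ, Finset.sum_range_zero, zero_add]
    rw [ENNReal.ofReal_add (hω 0).le (hω 1).le]
  -- Strict positivity handles negative `s`, where `ENNReal.ofReal s = 0` and the event must still
  -- be null.
  have h5 : 0 < partialSum σ 2 ω + (explosionTime 2 fun k => σ k ω).toReal := by
    have : 0 < partialSum σ 2 ω := Finset.sum_pos (fun j _ => hω j) (by simp)
    have : 0 ≤ (explosionTime 2 fun k => σ k ω).toReal := ENNReal.toReal_nonneg
    linarith
  change (explosionTime 0 (fun k => σ k ω) ≤ ENNReal.ofReal s) =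
    (partialSum σ 2 ω + (explosionTime 2 fun k => σ k ω).toReal ≤ s)
  rw [h3, eq_iff_iff]
  rcases le_or_gt 0 s with hs | hs
  · exact ENNReal.ofReal_le_ofReal_iff hs
  · rw [ENNReal.ofReal_of_nonpos hs.le, nonpos_iff_eq_zero, ENNReal.ofReal_eq_zero]
    constructor <;> intro <;> linarith

theorem hasDerivAt_timeCDF (h : IsExpSeq P σ r) (hr : Summable fun k => 1 / r k) (s : ℝ) :
    HasDerivAt (timeCDF P (fun ω => explosionTime 0 fun k => σ k ω))
      (∫ ω, sumDensity P σ r 0 (s - (explosionTime 2 fun k => σ k ω).toReal) ∂P) s := by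
  rw [h.timeCDF_eq_distFun hr]
  exact h.hasDerivAt_distFun_two_add
    (φ := fun y => (∑' k : ℕ, ENNReal.ofReal (y ⟨2 + k, by simp⟩)).toReal)
    (Measurable.ennreal_toReal (Measurable.tsum fun k => by fun_prop)) s

theorem timeDensity_eq_integral (h : IsExpSeq P σ r) (hr : Summable fun k => 1 / r k) (s : ℝ) :
    timeDensity P (fun ω => explosionTime 0 fun k => σ k ω) s =
      ∫ ω, sumDensity P σ r 0 (s - (explosionTime 2 fun k => σ k ω).toReal) ∂P :=
  (h.hasDerivAt_timeCDF hr s).deriv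

theorem tendsto_sumDensity (h : IsExpSeq P σ r) (hr : Summable fun k => 1 / r k) (s : ℝ) :
    Tendsto (fun n => sumDensity P σ r n s) atTop
      (𝓝 (timeDensity P (fun ω => explosionTime 0 fun k => σ k ω) s)) := by
  rw [h.timeDensity_eq_integral hr]
  rw [funext fun n => h.sumDensity_eq_integral n s]
  refine tendsto_integral_of_dominated_convergence (fun _ => r 1) (fun n => ?_)
    (integrable_const _) (fun n => ae_of_all _ fun ω => h.abs_sumDensity_zero_le _) ?_
  · exact ((h.sumDensity_continuous 0).measurable.comp (measurable_const.sub
      (Finset.measurable_sum _ fun j _ => h.meas (2 + j)))).aestronglyMeasurable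
  · filter_upwards [h.ae_pos, h.ae_explosionTime_lt_top hr] with ω hω hT
    have h2 := explosionTime_ne_top_of_zero hT 2
    refine ((h.sumDensity_continuous 0).tendsto _).comp (tendsto_const_nhds.sub ?_)
    have h3 := (ENNReal.hasSum_toReal h2.ne).tendsto_sum_nat
    rw [explosionTime, ENNReal.tsum_toReal_eq fun _ => ENNReal.ofReal_ne_top]
    refine h3.congr fun n => Finset.sum_congr rfl fun j _ => ?_
    exact ENNReal.toReal_ofReal (hω _).le

/-- The integrand is positive whenever the tail from the third term on is below `s`, an event of
positive probability. -/
theorem timeDensity_pos (h : IsExpSeq P σ r) (hr : Summable fun k => 1 / r k) {s : ℝ}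
    (hs : 0 < s) : 0 < timeDensity P (fun ω => explosionTime 0 fun k => σ k ω) s := by
  have hm := (measurable_explosionTime (σ := σ) 2 fun k _ => h.meas k).ennreal_toReal
  have hi : Integrable (fun ω =>
      sumDensity P σ r 0 (s - (explosionTime 2 fun k => σ k ω).toReal)) P :=
    integrable_of_measurable_of_bound
      ((h.sumDensity_continuous 0).measurable.comp (measurable_const.sub hm)) (r 1)
      fun ω => h.abs_sumDensity_zero_le _
  rw [h.timeDensity_eq_integral hr, integral_pos_iff_support_of_nonneg
    (fun ω => h.sumDensity_nonneg 0 _) hi]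
  refine (h.measure_explosionTime_lt_pos hr 2 hs).trans_le (measure_mono fun ω hω => ?_)
  refine (h.sumDensity_zero_pos (sub_pos.2 ?_)).ne'
  exact (ENNReal.lt_ofReal_iff_toReal_lt (ne_top_of_lt hω)).1 hω

theorem abs_timeDensity_le (h : IsExpSeq P σ r) (hr : Summable fun k => 1 / r k) (s : ℝ) :
    |timeDensity P (fun ω => explosionTime 0 fun k => σ k ω) s| ≤ r 1 :=
  le_of_tendsto' (h.tendsto_sumDensity hr s).abs fun n => h.abs_sumDensity_le n s

/-- The law of the birth process at a fixed time, in terms of the densities of its birth times. -/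
theorem measureReal_partialSum (h : IsExpSeq P σ r) (n : ℕ) (s : ℝ) :
    P.real {ω | partialSum σ (n + 1) ω < s ∧ s ≤ partialSum σ (n + 2) ω} =
      sumDensity P σ r n s / r (n + 1) := by
  -- By continuity of the distribution function, approached from the left, the sums have no atoms.
  have hlt : ∀ n, P.real {ω | partialSum σ (n + 1) ω < s} =
      distFun P (partialSum σ (n + 1)) s := by
    intro n
    refine le_antisymm (measureReal_mono (Set.ofPred_subset_ofPred.2 fun ω hω => hω.le)) ?_
    refine le_of_tendsto (((h.distFun_partialSum_continuous n).tendsto s).mono_left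
      (nhdsWithin_le_nhds (s := Set.Iio s))) ?_
    filter_upwards [self_mem_nhdsWithin] with u hu
    exact measureReal_mono (Set.ofPred_subset_ofPred.2 fun ω hω => lt_of_le_of_lt hω hu)
  rw [sumDensity, mul_div_cancel_left₀ _ (h.pos _).ne', ← hlt, ← hlt (n + 1), eq_sub_iff_add_eq,
    ← measureReal_union]
  · refine measureReal_congr ?_
    filter_upwards [h.ae_pos] with ω hω
    have := hω (n + 1)
    have h1 : partialSum σ (n + 2) ω = partialSum σ (n + 1) ω + σ (n + 1) ω := by
      rw [partialSum_succ σ (n + 1)]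
    change ((partialSum σ (n + 1) ω < s ∧ s ≤ partialSum σ (n + 2) ω) ∨
      partialSum σ (n + 2) ω < s) = (partialSum σ (n + 1) ω < s)
    rw [eq_iff_iff]
    constructor
    · rintro (h2 | h2)
      · exact h2.1
      · linarith
    · intro h2
      rcases le_or_gt s (partialSum σ (n + 2) ω) with h3 | h3
      · exact Or.inl ⟨h2, h3⟩
      · exact Or.inr h3
  · rw [Set.disjoint_left]
    exact fun ω h1 h2 => absurd h1.2 (not_le.2 h2)
  · exact measurableSet_lt (h.measurable_partialSum _) measurable_const

end IsExpSeq

end OneColour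

end PolyaUrn

namespace PolyaUrn

/-! ### Several colours: factorisation and joint asymptotics -/

section ManyColours

variable {Ω : Type*} [MeasurableSpace Ω] {P : Measure Ω}

/-- Independence means that the joint law is a product measure, and currying turns a product over
pairs into a product of products. -/
theorem iIndepFun_curry [IsProbabilityMeasure P] {ι κ E : Type*} [MeasurableSpace E]
    {X : ι → κ → Ω → E}
    (mX : ∀ i j, Measurable (X i j)) (h : iIndepFun (fun p : ι × κ => X p.1 p.2) P) :
    iIndepFun (fun i ω j => X i j ω) P := by
  have hp : ∀ i j, IsProbabilityMeasure (P.map (X i j)) := fun i j =>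
    Measure.isProbabilityMeasure_map (mX i j).aemeasurable
  have h2 : ∀ i, P.map (fun ω j => X i j ω) = Measure.infinitePi fun j => P.map (X i j) :=
    fun i => (h.precomp (g := fun j => (i, j)) (Prod.mk_right_injective i)
      ).map_fun_eq_infinitePi_map
      (mX i)
  rw [iIndepFun_iff_map_fun_eq_infinitePi_map fun i => measurable_pi_lambda _ (mX i)]
  have hm : Measurable fun ω (p : ι × κ) => X p.1 p.2 ω :=
    measurable_pi_lambda _ fun p => mX p.1 p.2
  have h3 : P.map (fun ω (p : ι × κ) => X p.1 p.2 ω) =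
      Measure.infinitePi fun p : ι × κ => P.map (X p.1 p.2) :=
    h.map_fun_eq_infinitePi_map fun p => mX p.1 p.2
  simp only [h2]
  rw [← Measure.infinitePi_map_curry fun i j => P.map (X i j), ← h3,
    Measure.map_map (MeasurableEquiv.measurable _) hm]
  rfl

theorem explosionTime_eq_shift (m : ℕ) (τ : ℕ → ℝ) :
    explosionTime m τ = explosionTime 0 fun k => τ (m + k) := by
  simp [explosionTime]

theorem Explosive.summable_shift {F : ℕ → ℝ} (h : Explosive F) {m : ℕ} (hm : 1 ≤ m) :
    Summable fun k => 1 / F (m + k) := by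
  have h1 := (summable_nat_add_iff (m - 1)).2 h
  refine h1.congr fun k => ?_
  rw [show k + (m - 1) + 1 = m + k by omega]

variable {ι : Type*} {F : ι → ℕ → ℝ} {m : ι → ℕ} {τ : ι → ℕ → Ω → ℝ}

/-- Independent exponential sojourn times: `τ i k` has rate `F i k`, for `k = 1, 2, …`; the colour
`i` starts with `m i` balls. -/
structure IsSojournFamily (P : Measure Ω) (F : ι → ℕ → ℝ) (m : ι → ℕ) (τ : ι → ℕ → Ω → ℝ) :
    Prop where
  rate_pos : ∀ i, ∀ k ≥ 1, 0 < F i k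
  one_le : ∀ i, 1 ≤ m i
  meas : ∀ i, ∀ k ≥ 1, Measurable (τ i k)
  law : ∀ i, ∀ k ≥ 1, HasLaw (τ i k) (expMeasure (F i k)) P
  indep : iIndepFun (fun p : ι × ℕ+ => τ p.1 (p.2 : ℕ)) P

/-- The minimum of the explosion times of the colours outside the range of `e`. -/
noncomputable def minTimeOutside {κ : Type*} (e : κ → ι) (m : ι → ℕ) (τ : ι → ℕ → ℝ) : ℝ≥0∞ :=
  ⨅ j, ⨅ _ : j ∉ Set.range e, explosionTime (m j) (τ j)

namespace IsSojournFamily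

theorem one_le_add (h : IsSojournFamily P F m τ) (i : ι) (k : ℕ) : 1 ≤ m i + k :=
  (h.one_le i).trans (Nat.le_add_right _ _)

theorem meas_add (h : IsSojournFamily P F m τ) (i : ι) (k : ℕ) : Measurable (τ i (m i + k)) :=
  h.meas i _ (h.one_le_add i k)

theorem indep_shift (h : IsSojournFamily P F m τ) :
    iIndepFun (fun p : ι × ℕ => τ p.1 (m p.1 + p.2)) P := by
  refine h.indep.precomp (g := fun p : ι × ℕ => (p.1, ⟨m p.1 + p.2, h.one_le_add p.1 p.2⟩)) ?_
  rintro ⟨i, k⟩ ⟨j, l⟩ hkl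
  obtain rfl : i = j := congrArg Prod.fst hkl
  have h3 : m i + k = m i + l := congrArg (fun p => (p.2 : ℕ)) hkl
  rw [Nat.add_left_cancel h3]

theorem isExpSeq (h : IsSojournFamily P F m τ) (i : ι) :
    IsExpSeq P (fun k => τ i (m i + k)) fun k => F i (m i + k) where
  pos k := h.rate_pos i _ (h.one_le_add i k)
  meas k := h.meas_add i k
  law k := h.law i _ (h.one_le_add i k)
  indep := h.indep_shift.precomp (g := fun k => (i, k)) (Prod.mk_right_injective i)

theorem measurable_minTimeOutside [Countable ι] {κ : Type*} (h : IsSojournFamily P F m τ)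
    (e : κ → ι) : Measurable fun ω => minTimeOutside e m fun i k => τ i k ω :=
  Measurable.iInf fun j => Measurable.iInf fun _ =>
    measurable_explosionTime (m j) fun k hk => h.meas j k ((h.one_le j).trans hk)

variable [IsProbabilityMeasure P]

theorem ae_pos [Countable ι] (h : IsSojournFamily P F m τ) :
    ∀ᵐ ω ∂P, ∀ i, ∀ k ≥ m i, 0 < τ i k ω := by
  refine ae_all_iff.2 fun i => ?_
  filter_upwards [(h.isExpSeq i).ae_pos] with ω hω k hk
  obtain ⟨l, rfl⟩ := Nat.exists_eq_add_of_le hk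
  exact hω l

theorem indep_colours (h : IsSojournFamily P F m τ) :
    iIndepFun (fun i ω k => τ i (m i + k) ω) P :=
  iIndepFun_curry (fun i k => h.meas_add i k) h.indep_shift

theorem ae_minTimeOutside_lt_top {κ : Type*} (h : IsSojournFamily P F m τ) {e : κ → ι}
    (he : ∃ j ∉ Set.range e, Explosive (F j)) :
    ∀ᵐ ω ∂P, minTimeOutside e m (fun i k => τ i k ω) < ∞ := by
  obtain ⟨j, hj, hF⟩ := he
  filter_upwards [(h.isExpSeq j).ae_explosionTime_lt_top (hF.summable_shift (h.one_le j))] with ω hω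
  refine lt_of_le_of_lt (iInf₂_le j hj) ?_
  rwa [explosionTime_eq_shift]

theorem ae_minTimeOutside_pos [Finite ι] {κ : Type*} (h : IsSojournFamily P F m τ) (e : κ → ι) :
    ∀ᵐ ω ∂P, 0 < minTimeOutside e m (fun i k => τ i k ω) := by
  filter_upwards [h.ae_pos] with ω hω
  rcases isEmpty_or_nonempty ι with hι | hι
  · rw [minTimeOutside, iInf_of_empty]
    exact ENNReal.zero_lt_top
  · obtain ⟨j, hj⟩ := exists_eq_ciInf_of_finite
      (f := fun i => explosionTime (m i) fun k => τ i k ω)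
    have h1 : ⨅ i, explosionTime (m i) (fun k => τ i k ω) ≤
        minTimeOutside e m fun i k => τ i k ω :=
      le_iInf fun j => le_iInf fun _ => iInf_le _ j
    refine lt_of_lt_of_le ?_ h1
    rw [← hj]
    exact lt_of_le_of_lt zero_le (birthTime_lt_explosionTime (hω j) 0)

theorem indepFun_minTimeOutside [Countable ι] {κ : Type*} (h : IsSojournFamily P F m τ)
    (e : κ → ι) :
    IndepFun (fun ω l k => τ (e l) (m (e l) + k) ω)
      (fun ω => (minTimeOutside e m fun i k => τ i k ω).toReal) P := by
  have h1 := indepFun_restrict_of_disjoint h.indep_colours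
    (fun i => measurable_pi_lambda _ fun k => h.meas_add i k)
    (disjoint_compl_right (a := Set.range e))
  have hφ : Measurable fun (y : Set.range e → ℕ → ℝ) (l : κ) => y ⟨e l, Set.mem_range_self l⟩ :=
    measurable_pi_lambda _ fun l => measurable_pi_apply _
  have hψ : Measurable fun y : ((Set.range e)ᶜ : Set ι) → ℕ → ℝ =>
      (⨅ j, ⨅ hj : j ∉ Set.range e, ∑' k : ℕ, ENNReal.ofReal (y ⟨j, hj⟩ k)).toReal :=
    Measurable.ennreal_toReal (Measurable.iInf fun j => Measurable.iInf fun hj =>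
      Measurable.tsum fun k => by fun_prop)
  exact h1.comp hφ hψ

/-- The joint law of the final numbers of the colours in the range of `e`. -/
theorem measureReal_forall_urnLimit_eq [Finite ι] {κ : Type*} [Fintype κ]
    (h : IsSojournFamily P F m τ) {e : κ → ι} (he : Function.Injective e)
    (hS : ∃ j ∉ Set.range e, Explosive (F j)) (n : κ → ℕ) :
    P.real {ω | ∀ l, urnLimit m (fun i k => τ i k ω) (e l) = (m (e l) + n l + 1 : ℕ)} =
      ∫ ω, ∏ l, (sumDensity P (fun k => τ (e l) (m (e l) + k))
        (fun k => F (e l) (m (e l) + k)) (n l)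
        (minTimeOutside e m fun i k => τ i k ω).toReal / F (e l) (m (e l) + (n l + 1))) ∂P := by
  have hι : Nonempty ι := ⟨hS.choose⟩
  let σ : κ → ℕ → Ω → ℝ := fun l k => τ (e l) (m (e l) + k)
  let B : Set ((κ → ℕ → ℝ) × ℝ) := {p | ∀ l, ∑ j ∈ Finset.range (n l + 1), p.1 l j < p.2 ∧
    p.2 ≤ ∑ j ∈ Finset.range (n l + 2), p.1 l j}
  have hB : MeasurableSet B := by
    have e : B = ⋂ l, ({p | ∑ j ∈ Finset.range (n l + 1), p.1 l j < p.2} ∩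
        {p | p.2 ≤ ∑ j ∈ Finset.range (n l + 2), p.1 l j}) := by
      ext p
      simp [B]
    rw [e]
    exact MeasurableSet.iInter fun l => (measurableSet_lt (by fun_prop) (by fun_prop)).inter
      (measurableSet_le (by fun_prop) (by fun_prop))
  have hU : Measurable fun ω l k => σ l k ω :=
    measurable_pi_lambda _ fun l => measurable_pi_lambda _ fun k => h.meas_add (e l) k
  have hV := (h.measurable_minTimeOutside e).ennreal_toReal
  have h1 : P.real {ω | ∀ l, urnLimit m (fun i k => τ i k ω) (e l) = (m (e l) + n l + 1 : ℕ)} =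
      P.real {ω | ((fun l k => σ l k ω),
        (minTimeOutside e m fun i k => τ i k ω).toReal) ∈ B} := by
    refine measureReal_congr ?_
    filter_upwards [h.ae_pos, h.ae_minTimeOutside_lt_top hS] with ω hω hT
    refine propext ((forall_urnLimit_eq_iff hω e fun l => m (e l) + n l).trans
      (forall_congr' fun l => ?_))
    have hb : ∀ k, birthTime (m (e l)) (fun k => τ (e l) k ω) (m (e l) + k) =
        ENNReal.ofReal (∑ j ∈ Finset.range (k + 1), σ l j ω) := by
      intro k
      rw [birthTime_eq_sum_range, ENNReal.ofReal_sum_of_nonneg]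
      exact fun j _ => (hω _ _ (Nat.le_add_right _ _)).le
    have h0 : ∀ k, 0 ≤ ∑ j ∈ Finset.range k, σ l j ω := fun k =>
      Finset.sum_nonneg fun j _ => (hω _ _ (Nat.le_add_right _ _)).le
    rw [add_assoc (m (e l)), hb, hb]
    exact and_congr (ENNReal.ofReal_lt_iff_lt_toReal (h0 _) hT.ne)
      (ENNReal.le_ofReal_iff_toReal_le hT.ne (h0 _))
  rw [h1, measureReal_indep_eq_integral hU hV (h.indepFun_minTimeOutside e) hB]
  congr 1 with ω
  set s := (minTimeOutside e m fun i k => τ i k ω).toReal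
  -- With `s` frozen, independence between colours factorises the event into the one-colour events.
  have hi := (h.indep_colours.precomp he).meas_iInter (s := fun l =>
    {ω | partialSum (σ l) (n l + 1) ω < s ∧ s ≤ partialSum (σ l) (n l + 2) ω}) ?_
  · simp only [← (h.isExpSeq _).measureReal_partialSum]
    simp only [measureReal_def, ← ENNReal.toReal_prod]
    rw [← hi]
    congr 2
    ext ω'
    simp [B, partialSum, σ]
  · intro l
    refine ⟨{y | ∑ j ∈ Finset.range (n l + 1), y j < s} ∩
      {y | s ≤ ∑ j ∈ Finset.range (n l + 2), y j}, ?_, rfl⟩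
    exact (measurableSet_lt (by fun_prop) (by fun_prop)).inter
      (measurableSet_le (by fun_prop) (by fun_prop))

theorem integrable_prod_timeDensity [Countable ι] {κ : Type*} [Fintype κ]
    (h : IsSojournFamily P F m τ) {e : κ → ι} (he : ∀ l, Explosive (F (e l))) :
    Integrable (fun ω => ∏ l, timeDensity P
      (fun ω => explosionTime (m (e l)) fun k => τ (e l) k ω)
      (minTimeOutside e m fun i k => τ i k ω).toReal) P := by
  refine integrable_of_measurable_of_bound (Finset.measurable_prod _ fun _ _ =>
    (measurable_deriv _).comp (h.measurable_minTimeOutside e).ennreal_toReal)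
    (∏ l, F (e l) (m (e l) + 1)) fun ω => ?_
  rw [Finset.abs_prod]
  refine Finset.prod_le_prod (fun l _ => abs_nonneg _) fun l _ => ?_
  simp only [explosionTime_eq_shift (m (e l))]
  exact (h.isExpSeq (e l)).abs_timeDensity_le ((he l).summable_shift (h.one_le _)) _

theorem integral_prod_timeDensity_pos [Finite ι] {κ : Type*} [Fintype κ]
    (h : IsSojournFamily P F m τ) {e : κ → ι} (he : ∀ l, Explosive (F (e l)))
    (hS : ∃ j ∉ Set.range e, Explosive (F j)) :
    0 < ∫ ω, ∏ l, timeDensity P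
      (fun ω => explosionTime (m (e l)) fun k => τ (e l) k ω)
      (minTimeOutside e m fun i k => τ i k ω).toReal ∂P := by
  refine integral_pos_of_ae_pos (h.integrable_prod_timeDensity he) ?_
  filter_upwards [h.ae_minTimeOutside_pos e, h.ae_minTimeOutside_lt_top hS] with ω h0 h1
  refine Finset.prod_pos fun l _ => ?_
  simp only [explosionTime_eq_shift (m (e l))]
  exact (h.isExpSeq (e l)).timeDensity_pos ((he l).summable_shift (h.one_le _))
    (ENNReal.toReal_pos h0.ne' h1.ne)

/-- The asymptotics of the joint law of the final numbers of the colours in the range of `e`. -/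
theorem tendsto_measureReal_mul_prod [Finite ι] {κ : Type*} [Fintype κ]
    (h : IsSojournFamily P F m τ) {e : κ → ι} (hinj : Function.Injective e)
    (he : ∀ l, Explosive (F (e l))) (hS : ∃ j ∉ Set.range e, Explosive (F j)) :
    Tendsto (fun x : κ → ℕ =>
      P.real {ω | ∀ l, urnLimit m (fun i k => τ i k ω) (e l) = (x l : ℕ∞)} * ∏ l, F (e l) (x l))
      (Filter.pi fun _ => atTop)
      (𝓝 (∫ ω, ∏ l, timeDensity P
        (fun ω => explosionTime (m (e l)) fun k => τ (e l) k ω)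
        (minTimeOutside e m fun i k => τ i k ω).toReal ∂P)) := by
  let f : κ → ℕ → ℝ → ℝ := fun l =>
    sumDensity P (fun k => τ (e l) (m (e l) + k)) fun k => F (e l) (m (e l) + k)
  have hV := (h.measurable_minTimeOutside e).ennreal_toReal
  -- A final number `x l` corresponds to the density index `x l - (m (e l) + 1)`; the truncated
  -- subtraction is exact once `x l` is large.
  have hn : Tendsto (fun (x : κ → ℕ) l => x l - (m (e l) + 1)) (Filter.pi fun _ => atTop)
      (Filter.pi fun _ => atTop) :=
    tendsto_pi.2 fun l => (tendsto_sub_atTop_nat _).comp (tendsto_eval_pi _ l)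
  have hlim : Tendsto (fun n : κ → ℕ =>
      ∫ ω, ∏ l, f l (n l) (minTimeOutside e m fun i k => τ i k ω).toReal ∂P)
      (Filter.pi fun _ => atTop)
      (𝓝 (∫ ω, ∏ l, timeDensity P
        (fun ω => explosionTime (m (e l)) fun k => τ (e l) k ω)
        (minTimeOutside e m fun i k => τ i k ω).toReal ∂P)) := by
    refine tendsto_integral_filter_of_dominated_convergence
      (fun _ => ∏ l, F (e l) (m (e l) + 1)) (Eventually.of_forall fun n => ?_)
      (Eventually.of_forall fun n => ae_of_all _ fun ω => ?_) (integrable_const _)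
      (ae_of_all _ fun ω => ?_)
    · exact (Finset.measurable_prod _ fun l _ =>
        ((h.isExpSeq (e l)).sumDensity_continuous (n l)).measurable.comp hV).aestronglyMeasurable
    · rw [Real.norm_eq_abs, Finset.abs_prod]
      exact Finset.prod_le_prod (fun l _ => abs_nonneg _)
        fun l _ => (h.isExpSeq (e l)).abs_sumDensity_le _ _
    · refine tendsto_finsetProd _ fun l _ => ?_
      simp only [explosionTime_eq_shift (m (e l))]
      exact ((h.isExpSeq (e l)).tendsto_sumDensity ((he l).summable_shift (h.one_le _)) _).comp
        (tendsto_eval_pi _ l)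
  refine (hlim.comp hn).congr' ?_
  have hx : ∀ᶠ x : κ → ℕ in Filter.pi fun _ => atTop, ∀ l, m (e l) + 1 ≤ x l :=
    eventually_all.2 fun l => (tendsto_eval_pi _ l).eventually (eventually_ge_atTop _)
  filter_upwards [hx] with x hx
  have hxe : ∀ l, m (e l) + (x l - (m (e l) + 1)) + 1 = x l := fun l => by
    have := hx l
    omega
  have h1 := h.measureReal_forall_urnLimit_eq hinj hS fun l => x l - (m (e l) + 1)
  simp only [hxe, ← add_assoc, Finset.prod_div_distrib, integral_div] at h1
  rw [h1, div_mul_cancel₀]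
  · rfl
  · exact (Finset.prod_pos fun l _ =>
      h.rate_pos _ _ ((Nat.le_add_left 1 _).trans (hx l))).ne'

end IsSojournFamily

end ManyColours

end PolyaUrn

/-! ### The quotient of joint and marginal asymptotics -/

theorem mainTheorem3 {Ω : Type*} [MeasurableSpace Ω] (P : Measure Ω) [IsProbabilityMeasure P]
    (A a : ℕ) (ha : 1 ≤ a) (haA : a < A)
    -- feedback functions and initial configuration
    (F : Fin A → ℕ → ℝ) (hF : ∀ i, ∀ k ≥ 1, 0 < F i k)
    (m : Fin A → ℕ) (hm : ∀ i, 1 ≤ m i)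
    -- independent exponential sojourn times: `τ i k` has rate `F i k`, for `k = 1, 2, …`
    (τ : Fin A → ℕ → Ω → ℝ) (hτ : ∀ i, ∀ k ≥ 1, Measurable (τ i k))
    (hlaw : ∀ i, ∀ k ≥ 1, HasLaw (τ i k) (expMeasure (F i k)) P)
    (hindep : iIndepFun (fun p : Fin A × ℕ+ => τ p.1 (p.2 : ℕ)) P)
    -- at least `a + 1` colours are explosive, the first `a` of them included
    (hcard : a + 1 ≤ {i : Fin A | PolyaUrn.Explosive (F i)}.ncard)
    (hexp : ∀ i : Fin a, PolyaUrn.Explosive (F (Fin.castLE haA.le i))) :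
    let X : Fin a → Ω → ℕ∞ := fun i ω =>
      PolyaUrn.urnLimit m (fun j k => τ j k ω) (Fin.castLE haA.le i)
    let T : Ω → Fin A → ℝ≥0∞ := fun ω j => PolyaUrn.explosionTime (m j) (fun k => τ j k ω)
    let G : Fin a → ℝ → ℝ := fun i => PolyaUrn.timeCDF P (fun ω => T ω (Fin.castLE haA.le i))
    let g : Fin a → ℝ → ℝ := fun i => PolyaUrn.timeDensity P (fun ω => T ω (Fin.castLE haA.le i))
    let S : Ω → ℝ≥0∞ := fun ω => PolyaUrn.minTimeFrom a (T ω)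
    let S' : Fin a → Ω → ℝ≥0∞ := fun i ω => PolyaUrn.minTimeOther (Fin.castLE haA.le i) (T ω)
    -- the densities exist, and the expectations are finite and positive
    (∀ i, Differentiable ℝ (G i)) ∧
    (∀ᵐ ω ∂P, S ω < ∞) ∧ (∀ i, ∀ᵐ ω ∂P, S' i ω < ∞) ∧
    Integrable (fun ω => ∏ i, g i (S ω).toReal) P ∧
    0 < ∫ ω, ∏ i, g i (S ω).toReal ∂P ∧
    (∀ i, Integrable (fun ω => g i (S' i ω).toReal) P) ∧
    (∀ i, 0 < ∫ ω, g i (S' i ω).toReal ∂P) ∧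
    -- the quotient of both sides tends to `1` as all `x i` tend to infinity
    Tendsto
      (fun x : Fin a → ℕ =>
        P.real {ω | ∀ i, X i ω = (x i : ℕ∞)} /
          ((∫ ω, ∏ i, g i (S ω).toReal ∂P) / (∏ i, ∫ ω, g i (S' i ω).toReal ∂P) *
            ∏ i, P.real {ω | X i ω = (x i : ℕ∞)}))
      (Filter.pi fun _ => atTop) (𝓝 1) := by

  intro X T G g S S'
  have h : PolyaUrn.IsSojournFamily P F m τ := ⟨hF, hm, hτ, hlaw, hindep⟩
  set e : Fin a → Fin A := Fin.castLE haA.le with he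
  have hinj : Function.Injective e := Fin.castLE_injective haA.le
  have hrange : ∀ j : Fin A, a ≤ (j : ℕ) ↔ j ∉ Set.range e := by
    intro j
    rw [he, Fin.range_castLE]
    simp
  have hrange1 : ∀ i j : Fin A, j ≠ i ↔ j ∉ Set.range fun _ : Unit => i := by
    intro i j
    simp [eq_comm]
  obtain ⟨j₀, hj₀, hj₀F⟩ : ∃ j ∉ Set.range e, PolyaUrn.Explosive (F j) := by
    by_contra! hcon
    have hsub : {i : Fin A | PolyaUrn.Explosive (F i)} ⊆ Set.range e := fun j hj => by
      by_contra hjr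
      exact hcon j hjr hj
    have h1 := Set.ncard_le_ncard hsub
    rw [← Set.image_univ, Set.ncard_image_of_injective _ hinj, Set.ncard_univ,
      Nat.card_eq_fintype_card, Fintype.card_fin] at h1
    omega
  have hS : ∀ ω, S ω = PolyaUrn.minTimeOutside e m fun i k => τ i k ω := by
    intro ω
    exact iInf_congr fun j => iInf_congr_Prop (hrange j) fun _ => rfl
  have hS' : ∀ i ω, S' i ω = PolyaUrn.minTimeOutside (fun _ : Unit => e i) m
      fun i k => τ i k ω := by
    intro i ω
    exact iInf_congr fun j => iInf_congr_Prop (hrange1 (e i) j) fun _ => rfl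
  have hexO : ∃ j ∉ Set.range e, PolyaUrn.Explosive (F j) := ⟨j₀, hj₀, hj₀F⟩
  have hexO1 : ∀ i, ∃ j ∉ Set.range fun _ : Unit => e i, PolyaUrn.Explosive (F j) := fun i =>
    ⟨j₀, (hrange1 _ _).1 fun hji => hj₀ ⟨i, hji.symm⟩, hj₀F⟩
  have hint := h.integrable_prod_timeDensity hexp
  have hpos := h.integral_prod_timeDensity_pos hexp hexO
  have hlim := h.tendsto_measureReal_mul_prod hinj hexp hexO
  -- Selecting one colour through a `Unit`-indexed family turns the minimum outside the range into
  -- `S' i`, so the marginals are a special case of the joint statement.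
  have hint1 := fun i => h.integrable_prod_timeDensity (e := fun _ : Unit => e i) fun _ => hexp i
  have hpos1 := fun i =>
    h.integral_prod_timeDensity_pos (e := fun _ : Unit => e i) (fun _ => hexp i) (hexO1 i)
  have hlim1 := fun i => (h.tendsto_measureReal_mul_prod (e := fun _ : Unit => e i)
    (Function.injective_of_subsingleton _) (fun _ => hexp i) (hexO1 i)).comp
    (tendsto_pi.2 fun _ => tendsto_id)
  simp only [Finset.univ_unique, Finset.prod_singleton, forall_const, Function.comp_def,
    id] at hint1 hpos1 hlim1
  have hS0 : ∀ᵐ ω ∂P, S ω < ∞ := by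
    simp only [hS]
    exact h.ae_minTimeOutside_lt_top hexO
  have hS0' : ∀ i, ∀ᵐ ω ∂P, S' i ω < ∞ := by
    intro i
    simp only [hS']
    exact h.ae_minTimeOutside_lt_top (hexO1 i)
  have hG : ∀ i, Differentiable ℝ (G i) := by
    intro i s
    simp only [G, T, PolyaUrn.explosionTime_eq_shift (m _)]
    exact ((h.isExpSeq (e i)).hasDerivAt_timeCDF
      ((hexp i).summable_shift (hm _)) s).differentiableAt
  simp only [← hS, ← hS'] at hint hpos hlim hint1 hpos1 hlim1
  refine ⟨hG, hS0, hS0', hint, hpos, hint1, hpos1, ?_⟩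
  have hden := tendsto_finsetProd Finset.univ fun i _ =>
    (hlim1 i).comp (tendsto_eval_pi (fun _ : Fin a => (atTop : Filter ℕ)) i)
  have hposd := Finset.prod_pos fun i (_ : i ∈ Finset.univ) => hpos1 i
  have hquot := hlim.div (hden.const_mul
    ((∫ ω, ∏ i, g i (S ω).toReal ∂P) / (∏ i, ∫ ω, g i (S' i ω).toReal ∂P)))
    (mul_pos (div_pos hpos hposd) hposd).ne'
  have hone : (∫ ω, ∏ i, g i (S ω).toReal ∂P) /
      ((∫ ω, ∏ i, g i (S ω).toReal ∂P) / (∏ i, ∫ ω, g i (S' i ω).toReal ∂P) *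
        ∏ i, ∫ ω, g i (S' i ω).toReal ∂P) = 1 := by
    rw [div_mul_cancel₀ _ hposd.ne']
    exact div_self hpos.ne'
  rw [hone] at hquot
  refine hquot.congr' ?_
  have hx : ∀ᶠ x : Fin a → ℕ in Filter.pi fun _ => atTop, ∀ l, 1 ≤ x l :=
    eventually_all.2 fun l => (tendsto_eval_pi _ l).eventually (eventually_ge_atTop _)
  filter_upwards [hx] with x hx
  -- The product of the rates `F (e l) (x l)` occurs in numerator and denominator, and cancels
  -- because it is nonzero.
  have hFpos : ∏ l, F (e l) (x l) ≠ 0 := (Finset.prod_pos fun l _ => hF _ _ (hx l)).ne'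
  simp only [Pi.div_apply, Function.comp_def, Finset.prod_mul_distrib]
  rw [← mul_assoc, mul_div_mul_right _ _ hFpos]
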